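/- Let $k$ be a perfect field, let $S = k[x_1,\dots,x_d]$, and let $J \subset S$ be an ideal with $\dim S/J > 0$ that is generated by forms $(f_i)_{i}$ of the same degree. Let $\mathrm{bigheight}(J)$ denote the maximum of the heights of the minimal primes of $J$, and for an ideal $I\subset S$ and $n \ge 0$ let $$I^{(n)} = \bigcap_{P} \left(I^n S_P \cap S\right),$$ where $P$ ranges over the minimal primes of $I$ and $I^nS_P\cap S$ is the preimage of $I^nS_P$ in $S$, denote the $n$-th symbolic power. Then every $d\times d$ minor of the Jacobian matrix $(\partial f_i/\partial x_j)_{i,j}$ lies in $(\sqrt J)^{(d-\mathrm{bigheight}(J)+1)}$. -/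

import Mathlib

/-- The big height of an ideal: the supremum of the heights of its minimal primes. -/
noncomputable def bigHeight {R : Type*} [CommRing R] (I : Ideal R) : ℕ∞ :=
  ⨆ p ∈ I.minimalPrimes, p.height

/-- The `n`-th symbolic power of an ideal `I`: the intersection, over the minimal primes `p` of `I`,
of the contractions to `R` of the extensions of `I ^ n` to the localizations `R_p`.
(For a radical ideal of a Noetherian ring, the minimal primes are exactly the associated primes.) -/
noncomputable def symbolicPower {R : Type*} [CommRing R] (I : Ideal R) (n : ℕ) : Ideal R :=
  ⨅ (p : PrimeSpectrum R) (_ : p.asIdeal ∈ I.minimalPrimes),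
    ((I ^ n).map (algebraMap R (Localization.AtPrime p.asIdeal))).comap
      (algebraMap R (Localization.AtPrime p.asIdeal))

/-- The Jacobian matrix `(∂ f_i / ∂ x_j)` of a family of polynomials. -/
noncomputable def jacobianMatrix {k σ ι : Type*} [CommRing k] (f : ι → MvPolynomial σ k) :
    Matrix ι σ (MvPolynomial σ k) :=
  Matrix.of fun i j => MvPolynomial.pderiv j (f i)

/-!
Let `P` be a minimal prime of `J`, of height `h`. Locally at `P` the `d` chosen forms `f_i` are
combinations of `h` elements of `P`. Up to a unit at `P`, their Jacobian matrix is therefore, modulo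
`P`, the product of a `d × h` and an `h × d` matrix, which puts its determinant in `P ^ (d - h)`
locally. The extra factor comes from Euler's identity: as `J` is homogeneous and `dim S/J > 0`, some
variable `x_j` lies outside `P`, and multiplying the determinant by `x_j` amounts to replacing the
`j`-th column by `(δ f_i)_i`. There the factorization is exact, and the `j`-th column of the second
factor lies in `P`.
-/

open MvPolynomial

attribute [local instance] MvPolynomial.gradedAlgebra

theorem prod_mem_pow_card {R n : Type*} [CommSemiring R] [Fintype n] {I : Ideal R} {f : n → R}
    {s : Finset n} (hf : ∀ b ∈ s, f b ∈ I) : ∏ b, f b ∈ I ^ s.card := by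
  classical
  rw [← Finset.prod_mul_prod_compl s, ← Finset.prod_const]
  exact Ideal.mul_mem_right _ _ (Ideal.prod_mem_prod hf)

theorem card_sub_card_le_card_filter_isLeft {m n κ : Type*} [Fintype n] [Fintype κ]
    {φ : n → m ⊕ κ} (hφ : φ.Injective) :
    Fintype.card n - Fintype.card κ ≤ (Finset.univ.filter fun b => (φ b).isLeft).card := by
  have hright : (Finset.univ.filter fun b => ¬(φ b).isLeft).card ≤ Fintype.card κ := by
    rw [← Finset.card_univ, ← Finset.card_map (.inr : κ ↪ m ⊕ κ)]
    refine Finset.card_le_card_of_injOn φ (fun b hb => ?_) hφ.injOn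
    obtain ⟨l, hl⟩ := Sum.isRight_iff.mp (Sum.not_isLeft.mp (Finset.mem_filter.mp hb).2)
    exact Finset.mem_map.mpr ⟨l, Finset.mem_univ l, hl.symm⟩
  have hsplit := Finset.card_filter_add_card_filter_not (s := .univ) fun b => (φ b).isLeft
  rw [Finset.card_univ] at hsplit
  omega

theorem prod_fromBlocks_mem_pow {R m n κ : Type*} [CommRing R] [Fintype n] [Fintype κ]
    {I : Ideal R} {M : Matrix m n R} {A : Matrix m κ R} {B : Matrix κ n R} {D : Matrix κ κ R}
    {j : n} (hM : ∀ a b, M a b ∈ I) (hMj : ∀ a, M a j = 0) (hBj : ∀ l, B l j ∈ I)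
    {φ : n → m ⊕ κ} (hφ : φ.Injective) :
    ∏ b, Matrix.fromBlocks M A B D (φ b) (.inl b) ∈
      I ^ (Fintype.card n - Fintype.card κ + 1) := by
  classical
  rcases hφj : φ j with a | l
  · rw [Finset.prod_eq_zero (Finset.mem_univ j) (by rw [hφj, Matrix.fromBlocks_apply₁₁, hMj])]
    exact zero_mem _
  · let s : Finset n := {b | (φ b).isLeft}
    have hjs : j ∉ s := by simp [s, hφj]
    refine Ideal.pow_le_pow_right ?_ (prod_mem_pow_card (s := insert j s) fun b hb => ?_)
    · grw [Finset.card_insert_of_notMem hjs, card_sub_card_le_card_filter_isLeft hφ]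
    · rcases Finset.mem_insert.mp hb with rfl | hb
      · rw [hφj]
        exact hBj l
      · obtain ⟨a, ha⟩ := Sum.isLeft_iff.mp (Finset.mem_filter.mp hb).2
        rw [ha]
        exact hM a b

theorem det_mem_pow_of_sub_mul_mem {R n κ : Type*} [CommRing R] [Fintype n] [DecidableEq n]
    [Fintype κ] {I : Ideal R} {M : Matrix n n R} {A : Matrix n κ R} {B : Matrix κ n R} {j : n}
    (hM : ∀ a b, (M - A * B) a b ∈ I) (hMj : ∀ a, (M - A * B) a j = 0) (hBj : ∀ l, B l j ∈ I) :
    M.det ∈ I ^ (Fintype.card n - Fintype.card κ + 1) := by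
  classical
  -- In a Leibniz term of the bordered matrix at most `card κ` of the first `card n` columns use the
  -- bottom rows, and column `j` must be one of them.
  have hschur : M.det = (Matrix.fromBlocks (M - A * B) (-A) B 1).det := by
    rw [Matrix.det_fromBlocks_one₂₂, Matrix.neg_mul, sub_neg_eq_add, sub_add_cancel]
  rw [hschur, Matrix.det_apply]
  refine Ideal.sum_mem _ fun σ _ => Submodule.smul_of_tower_mem _ _ ?_
  rw [Fintype.prod_sum_type]
  exact Ideal.mul_mem_right _ _
    (prod_fromBlocks_mem_pow hM hMj hBj (σ.injective.comp Sum.inl_injective))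

section Derivation

variable {R S n κ : Type*} [CommRing R] [CommRing S] [Algebra R S] [Fintype κ]

theorem mul_derivation_sub_sum_mem {I : Ideal S} (D : Derivation R S S) {s f : S} {a g : κ → S}
    (hf : f ∈ I) (hg : ∀ l, g l ∈ I) (h : s * f = ∑ l, a l * g l) :
    s * D f - ∑ l, a l * D (g l) ∈ I := by
  have hD := congrArg D h
  simp only [map_sum, Derivation.leibniz, smul_eq_mul, Finset.sum_add_distrib] at hD
  have : s * D f - ∑ l, a l * D (g l) = ∑ l, g l * D (a l) - f * D s := by
    linear_combination hD
  rw [this]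
  exact I.sub_mem (I.sum_mem fun l _ => I.mul_mem_right _ (hg l)) (I.mul_mem_right _ hf)

variable [Fintype n] [DecidableEq n]

theorem prod_mul_det_derivation_mem_pow {I : Ideal S} (D : n → Derivation R S S)
    {s f : n → S} {g : κ → S} {a : Matrix n κ S} (hf : ∀ i, f i ∈ I) (hg : ∀ l, g l ∈ I)
    (hsf : ∀ i, s i * f i = ∑ l, a i l * g l) {x : n → S} {c : S}
    (hx : ∀ i, ∑ b, x b * D b (f i) = c * f i) (j : n) :
    (∏ i, s i) * x j * (Matrix.of fun i b => D b (f i)).det ∈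
      I ^ (Fintype.card n - Fintype.card κ + 1) := by
  let M : Matrix n n S := .of fun i b => s i * D b (f i)
  let N : Matrix n n S := M.updateCol j fun i => ∑ b, x b • M i b
  let B : Matrix κ n S := (Matrix.of fun l b => D b (g l)).updateCol j fun l => c * g l
  have hdet : N.det = (∏ i, s i) * x j * (Matrix.of fun i b => D b (f i)).det := by
    rw [Matrix.det_updateCol_sum, smul_eq_mul, mul_comm _ (x j), mul_assoc,
      ← Matrix.det_mul_column]
    rfl
  have hcol (i : n) : N i j = (a * B) i j :=
    calc N i j = s i * ∑ b, x b * D b (f i) := by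
          simp [N, M, Finset.mul_sum, mul_left_comm]
      _ = c * ∑ l, a i l * g l := by rw [hx, mul_left_comm, hsf]
      _ = (a * B) i j := by simp [B, Matrix.mul_apply, Finset.mul_sum, mul_left_comm]
  rw [← hdet]
  refine det_mem_pow_of_sub_mul_mem (A := a) (B := B) (j := j) (fun i b => ?_)
    (fun i => sub_eq_zero.mpr (hcol i)) fun l => ?_
  · obtain rfl | hb := eq_or_ne b j
    · simp [hcol]
    · simpa [N, M, B, hb, Matrix.mul_apply] using mul_derivation_sub_sum_mem (D b) (hf i) hg (hsf i)
  · simpa [B] using I.mul_mem_left c (hg l)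

end Derivation

theorem exists_map_span_range_eq {R A κ : Type*} [CommRing R] [CommRing A] [Algebra R A]
    (M : Submonoid R) [IsLocalization M A] {I : Ideal R} {g : κ → A}
    (hg : ∀ l, g l ∈ I.map (algebraMap R A)) :
    ∃ x : κ → R, (∀ l, x l ∈ I) ∧
      (Ideal.span (Set.range x)).map (algebraMap R A) = Ideal.span (Set.range g) := by
  choose y hy using fun l => (IsLocalization.mem_map_algebraMap_iff M A).mp (hg l)
  refine ⟨fun l => (y l).1, fun l => (y l).1.2, ?_⟩
  rw [Ideal.map_span, ← Set.range_comp]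
  refine le_antisymm (Ideal.span_le.mpr ?_) (Ideal.span_le.mpr ?_)
  · rintro _ ⟨l, rfl⟩
    rw [Function.comp_apply, ← hy l]
    exact Ideal.mul_mem_right _ _ (Ideal.subset_span ⟨l, rfl⟩)
  · rintro _ ⟨l, rfl⟩
    rw [SetLike.mem_coe, ← Ideal.mul_unit_mem_iff_mem _ (IsLocalization.map_units A (y l).2), hy l]
    exact Ideal.subset_span ⟨l, rfl⟩

theorem exists_map_span_range_eq_map_of_isRegularRing {R : Type*} [CommRing R] [IsRegularRing R]
    (P : Ideal R) [P.IsPrime] :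
    ∃ g : Fin P.height.toNat → R, (∀ l, g l ∈ P) ∧
      (Ideal.span (Set.range g)).map (algebraMap R (Localization.AtPrime P)) =
        P.map (algebraMap R (Localization.AtPrime P)) := by
  let A := Localization.AtPrime P
  let m := IsLocalRing.maximalIdeal A
  have hPm : P.map (algebraMap R A) = m := Localization.AtPrime.map_eq_maximalIdeal
  have hrank : m.spanFinrank = P.height.toNat := by
    have h := (isRegularLocalRing_iff A).mp inferInstance
    rw [IsLocalization.AtPrime.ringKrullDim_eq_height P] at h
    have hheight : (m.spanFinrank : ℕ∞) = P.height := WithBot.coe_inj.mp h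
    rw [← hheight, ENat.toNat_natCast]
  obtain ⟨s, hcard, hspan⟩ := Submodule.FG.exists_span_finset_card_eq_spanFinrank
    m.fg_of_isNoetherianRing
  let g : Fin P.height.toNat → A := (↑) ∘ (s.equivFinOfCardEq (hcard.trans hrank)).symm
  have hg : Ideal.span (Set.range g) = m := by
    rw [EquivLike.range_comp, Subtype.range_coe_subtype]
    exact hspan
  obtain ⟨x, hxP, hx⟩ := exists_map_span_range_eq P.primeCompl (I := P) (g := g) fun l =>
    hPm ▸ hg ▸ Ideal.subset_span ⟨l, rfl⟩
  exact ⟨x, hxP, hx.trans (hg.trans hPm.symm)⟩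

theorem exists_mul_det_derivation_mem_pow {R S n : Type*} [CommRing R] [CommRing S] [Algebra R S]
    [IsRegularRing S] [Fintype n] [DecidableEq n] {P : Ideal S} [P.IsPrime]
    (D : n → Derivation R S S) {f : n → S} (hf : ∀ i, f i ∈ P) {x : n → S} {c : S}
    (hx : ∀ i, ∑ b, x b * D b (f i) = c * f i) {j : n} (hj : x j ∉ P) :
    ∃ t ∉ P, t * (Matrix.of fun i b => D b (f i)).det ∈
      P ^ (Fintype.card n - P.height.toNat + 1) := by
  obtain ⟨g, hgP, hg⟩ := exists_map_span_range_eq_map_of_isRegularRing P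
  have hclear (i : n) : ∃ s ∉ P, s * f i ∈ Ideal.span (Set.range g) :=
    (IsLocalization.algebraMap_mem_map_algebraMap_iff P.primeCompl _ _ _).mp
      (hg ▸ Ideal.mem_map_of_mem _ (hf i))
  choose s hsP hs using hclear
  choose a ha using fun i => Ideal.mem_span_range_iff_exists_fun.mp (hs i)
  refine ⟨(∏ i, s i) * x j, ?_, ?_⟩
  · simpa [Ideal.IsPrime.mul_mem_iff_mem_or_mem, Ideal.IsPrime.prod_mem_iff, hj] using hsP
  · simpa using prod_mul_det_derivation_mem_pow D hf hgP (fun i => (ha i).symm) hx j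

theorem isHomogeneous_of_mem_minimalPrimes {ι A σ : Type*} [CommRing A] [SetLike σ A]
    [AddSubmonoidClass σ A] [AddCommMonoid ι] [LinearOrder ι] [IsOrderedCancelAddMonoid ι]
    {𝒜 : ι → σ} [GradedRing 𝒜] {J P : Ideal A} (hJ : J.IsHomogeneous 𝒜)
    (hP : P ∈ J.minimalPrimes) : P.IsHomogeneous 𝒜 := by
  have hcore : J ≤ (P.homogeneousCore 𝒜).toIdeal := by
    rw [← hJ.toIdeal_homogeneousCore_eq_self]
    exact Ideal.homogeneousCore_mono 𝒜 hP.1.2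
  refine (Ideal.IsHomogeneous.iff_eq 𝒜 P).mpr (le_antisymm (P.toIdeal_homogeneousCore_le 𝒜) ?_)
  exact hP.2 ⟨hP.1.1.homogeneousCore, hcore⟩ (P.toIdeal_homogeneousCore_le 𝒜)

theorem ker_constantCoeff_eq_idealOfVars (σ R : Type*) [CommSemiring R] :
    RingHom.ker (constantCoeff : MvPolynomial σ R →+* R) = idealOfVars σ R := by
  ext p
  rw [← pow_one (idealOfVars σ R), mem_pow_idealOfVars_iff']
  simp [constantCoeff_eq, Finsupp.degree_eq_zero_iff]

theorem isMaximal_idealOfVars (σ k : Type*) [Field k] : (idealOfVars σ k).IsMaximal := by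
  rw [← ker_constantCoeff_eq_idealOfVars]
  exact RingHom.ker_isMaximal_of_surjective _ fun c => ⟨C c, constantCoeff_C σ c⟩

theorem le_idealOfVars_of_isHomogeneous {σ k : Type*} [Field k] {I : Ideal (MvPolynomial σ k)}
    (hI : I.IsHomogeneous (homogeneousSubmodule σ k)) (htop : I ≠ ⊤) : I ≤ idealOfVars σ k := by
  intro p hp
  rw [← ker_constantCoeff_eq_idealOfVars, RingHom.mem_ker]
  by_contra hc
  have hmem : C (constantCoeff p) ∈ I := by
    rw [constantCoeff_eq, ← homogeneousComponent_zero]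
    exact homogeneousComponent_mem_of_mem hI hp 0
  exact htop (I.eq_top_of_isUnit_mem hmem ((isUnit_iff_ne_zero.mpr hc).map C))

theorem exists_X_notMem_of_mem_minimalPrimes {σ k : Type*} [Field k]
    {J P : Ideal (MvPolynomial σ k)} (hJ : J.IsHomogeneous (homogeneousSubmodule σ k))
    (hdim : 0 < ringKrullDim (MvPolynomial σ k ⧸ J)) (hP : P ∈ J.minimalPrimes) :
    ∃ j, X j ∉ P := by
  by_contra! hX
  have hmax := isMaximal_idealOfVars σ k
  have hvars : idealOfVars σ k = P :=
    hmax.eq_of_le hP.1.1.ne_top (Ideal.span_le.mpr (Set.range_subset_iff.mpr hX))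
  have hmin : ∀ Q ∈ J.minimalPrimes, Q = P := fun Q hQ => by
    have hQP : Q ≤ P := hvars ▸
      le_idealOfVars_of_isHomogeneous (isHomogeneous_of_mem_minimalPrimes hJ hQ) hQ.1.1.ne_top
    exact hQP.antisymm (hP.2 hQ.1 hQP)
  have hzero : Ring.KrullDimLE 0 (MvPolynomial σ k ⧸ J) :=
    Ideal.krullDimLE_zero_quotient_iff_forall_minimalPrimes_isMaximal.mpr fun Q hQ =>
      hmin Q hQ ▸ hvars ▸ hmax
  exact hdim.not_ge (Ring.krullDimLE_iff.mp hzero)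

section SymbolicPower

variable {R : Type*} [CommRing R]

theorem map_radical_atPrime_of_mem_minimalPrimes {J P : Ideal R} [P.IsPrime]
    (hP : P ∈ J.minimalPrimes) :
    J.radical.map (algebraMap R (Localization.AtPrime P)) =
      P.map (algebraMap R (Localization.AtPrime P)) := by
  rw [IsLocalization.map_radical P.primeCompl,
    IsLocalization.AtPrime.radical_map_of_mem_minimalPrimes _ P J hP]

theorem mem_symbolicPower_radical_iff {J : Ideal R} {n : ℕ} {x : R} :
    x ∈ symbolicPower J.radical n ↔ ∀ P ∈ J.minimalPrimes, ∃ t ∉ P, t * x ∈ P ^ n := by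
  have hlocal (P : Ideal R) [P.IsPrime] (hP : P ∈ J.minimalPrimes) :
      algebraMap R (Localization.AtPrime P) x ∈ (J.radical ^ n).map (algebraMap R _) ↔
        ∃ t ∉ P, t * x ∈ P ^ n := by
    rw [Ideal.map_pow, map_radical_atPrime_of_mem_minimalPrimes hP, ← Ideal.map_pow]
    exact IsLocalization.algebraMap_mem_map_algebraMap_iff P.primeCompl _ _ _
  simp only [symbolicPower, Ideal.radical_minimalPrimes, Submodule.mem_iInf, Ideal.mem_comap]
  exact ⟨fun h P hP => have := hP.1.1; (hlocal P hP).mp (h ⟨P, this⟩ hP),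
    fun h p hp => (hlocal p.asIdeal hp).mpr (h p.asIdeal hp)⟩

theorem bigHeight_ne_top [IsNoetherianRing R] (I : Ideal R) : bigHeight I ≠ ⊤ := by
  have : Finite I.minimalPrimes := I.finite_minimalPrimes_of_isNoetherianRing R
  rw [bigHeight, iSup_subtype']
  exact iSup_ne_top fun P => Ideal.height_ne_top P.2.1.1.ne_top

theorem height_toNat_le_bigHeight_toNat [IsNoetherianRing R] {I P : Ideal R}
    (hP : P ∈ I.minimalPrimes) : P.height.toNat ≤ (bigHeight I).toNat :=
  ENat.toNat_le_toNat (le_iSup₂_of_le P hP le_rfl) (bigHeight_ne_top I)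

end SymbolicPower

theorem exists_mul_det_jacobianMatrix_mem_pow {k σ : Type*} [CommRing k] [IsRegularRing k]
    [Fintype σ] [DecidableEq σ] {P : Ideal (MvPolynomial σ k)} [P.IsPrime]
    {f : σ → MvPolynomial σ k} {δ : ℕ} (hf : ∀ i, (f i).IsHomogeneous δ) (hfP : ∀ i, f i ∈ P)
    {j : σ} (hj : X j ∉ P) :
    ∃ t ∉ P, t * (jacobianMatrix f).det ∈ P ^ (Fintype.card σ - P.height.toNat + 1) :=
  exists_mul_det_derivation_mem_pow pderiv hfP (c := δ)
    (fun i => by rw [(hf i).sum_X_mul_pderiv, nsmul_eq_mul]) hj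

theorem proposition6p3_general {k σ : Type*} [Field k] [Fintype σ] [DecidableEq σ]
    {J : Ideal (MvPolynomial σ k)} (hJ : J.IsHomogeneous (homogeneousSubmodule σ k))
    (hdim : 0 < ringKrullDim (MvPolynomial σ k ⧸ J)) {f : σ → MvPolynomial σ k} {δ : ℕ}
    (hf : ∀ i, (f i).IsHomogeneous δ) (hfJ : ∀ i, f i ∈ J) :
    (jacobianMatrix f).det ∈
      symbolicPower J.radical (Fintype.card σ - (bigHeight J).toNat + 1) := by
  refine mem_symbolicPower_radical_iff.mpr fun P hP => ?_
  have : P.IsPrime := hP.1.1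
  obtain ⟨j, hj⟩ := exists_X_notMem_of_mem_minimalPrimes hJ hdim hP
  obtain ⟨t, htP, ht⟩ := exists_mul_det_jacobianMatrix_mem_pow hf (fun i => hP.1.2 (hfJ i)) hj
  refine ⟨t, htP, Ideal.pow_le_pow_right ?_ ht⟩
  grw [height_toNat_le_bigHeight_toNat hP]

theorem proposition6p3 {k : Type*} [Field k] [PerfectField k] {d : ℕ}
    {ι : Type*} (f : ι → MvPolynomial (Fin d) k) (δ : ℕ)
    (hf : ∀ i, (f i).IsHomogeneous δ)
    (J : Ideal (MvPolynomial (Fin d) k)) (hJ : J = Ideal.span (Set.range f))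
    (hdim : 0 < ringKrullDim (MvPolynomial (Fin d) k ⧸ J))
    (r : Fin d → ι) :
    ((jacobianMatrix f).submatrix r id).det ∈
      symbolicPower J.radical (d - (bigHeight J).toNat + 1) := by
  subst hJ
  have hhom : (Ideal.span (Set.range f)).IsHomogeneous (homogeneousSubmodule (Fin d) k) :=
    Ideal.homogeneous_span _ _ (Set.forall_mem_range.mpr fun i => ⟨δ, hf i⟩)
  have h := proposition6p3_general hhom hdim (f := f ∘ r) (fun i => hf (r i)) fun i =>
    Ideal.subset_span ⟨r i, rfl⟩
  rwa [Fintype.card_fin] at h
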